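/- All spaces carry their usual topologies. For a reduced commutative ring $R$ (no nonzero nilpotent elements), the reduced ring order is $r\le_{\mathrm{rr}} s \iff r^2=rs$; $R$ is \emph{rr-good} if every pair of its elements has an infimum for $\le_{\mathrm{rr}}$. A topological space $X$ is \emph{rr-good} if the ring $C(X)$ of continuous real-valued functions on $X$ is rr-good, and \emph{pseudocompact} if every $f\in C(X)$ is bounded. Let $\beta$ denote the Stone–Čech compactification, and regard $\beta\mathbb N$ as a subspace of $\beta\mathbb R$ via the embedding $\beta\mathbb N\to\beta\mathbb R$ that extends the inclusion $\mathbb N\subseteq\mathbb R\subseteq\beta\mathbb R$. Let $\Lambda=\beta\mathbb R\setminus(\beta\mathbb N\setminus\mathbb N)$, a subspace of $\beta\mathbb R$. Then: 1. $\Lambda$ is a connected, non-compact, pseudocompact, rr-good Tychonoff space. 2. $\Lambda\times\Lambda$ is pseudocompact but not rr-good. 3. $\beta\Lambda=\beta\mathbb R$ and $\beta(\Lambda\times\Lambda)=\beta\mathbb R\times\beta\mathbb R$; precisely, there is a homeomorphism $\beta\Lambda\to\beta\mathbb R$ that fixes every point of $\Lambda$, and a homeomorphism $\beta(\Lambda\times\Lambda)\to\beta\mathbb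 R\times\beta\mathbb R$ that fixes every point of $\Lambda\times\Lambda$. Moreover, $\beta\mathbb R\times\beta\mathbb R$ is not rr-good. -/

import Mathlib

/-- The reduced ring order: `r ≤ s` iff `r² = r s`. -/
def RRLe {R : Type*} [CommRing R] (r s : R) : Prop := r ^ 2 = r * s

/-- `t` is the infimum of `r` and `s` in the reduced ring order. -/
def IsRRInf {R : Type*} [CommRing R] (r s t : R) : Prop :=
  RRLe t r ∧ RRLe t s ∧ ∀ u : R, RRLe u r → RRLe u s → RRLe u t

/-- A reduced ring is rr-good if every pair of elements has an infimum in the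
reduced ring order. -/
def IsRRGoodRing (R : Type*) [CommRing R] [IsReduced R] : Prop :=
  ∀ r s : R, ∃ t : R, IsRRInf r s t

/-- The ring `C(X)` of continuous real-valued functions has no nonzero nilpotents. -/
instance continuousMapRealIsReduced (X : Type*) [TopologicalSpace X] : IsReduced C(X, ℝ) :=
  ⟨fun f hf => by
    obtain ⟨n, hn⟩ := hf
    ext x
    have h : f x ^ n = 0 := by
      simpa using congrArg (fun g : C(X, ℝ) => g x) hn
    by_contra ha
    exact pow_ne_zero n ha h⟩

/-- A space `X` is rr-good if the ring `C(X)` is rr-good. -/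
def IsRRGood (X : Type*) [TopologicalSpace X] : Prop := IsRRGoodRing C(X, ℝ)

/-- A space is pseudocompact if every continuous real-valued function on it is bounded. -/
def IsPseudocompact (X : Type*) [TopologicalSpace X] : Prop :=
  ∀ f : C(X, ℝ), ∃ M : ℝ, ∀ x : X, |f x| ≤ M

/-- The canonical map `βℕ → βℝ`, extending the inclusion `ℕ → ℝ ⊆ βℝ`. -/
noncomputable def betaNatToBetaReal : StoneCech ℕ → StoneCech ℝ :=
  stoneCechExtend (g := fun n : ℕ => stoneCechUnit (n : ℝ))
    (continuous_stoneCechUnit.comp continuous_of_discreteTopology)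

/-- The canonical map identifies `βℕ` with a subspace of `βℝ`. -/
theorem isClosedEmbedding_betaNatToBetaReal :
    Topology.IsClosedEmbedding betaNatToBetaReal := by
  refine (continuous_stoneCechExtend _).isClosedEmbedding ?_
  intro p q hpq
  by_contra hne
  obtain ⟨φ, hφp, hφq, hφ⟩ := exists_continuous_zero_one_of_isClosed
    (isClosed_singleton (x := p)) (isClosed_singleton (x := q))
    (Set.disjoint_singleton.2 hne)
  let ψ : StoneCech ℕ → Set.Icc (0 : ℝ) 1 := fun x => ⟨φ x, hφ x⟩
  have hψ : Continuous ψ := φ.continuous.subtype_mk hφ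
  obtain ⟨g, hg⟩ := ContinuousMap.exists_extension' Nat.isClosedEmbedding_coe_real
    (⟨ψ ∘ stoneCechUnit, hψ.comp continuous_stoneCechUnit⟩ : C(ℕ, Set.Icc (0 : ℝ) 1))
  have hext : stoneCechExtend g.continuous ∘ betaNatToBetaReal = ψ := by
    refine stoneCech_hom_ext
      ((continuous_stoneCechExtend _).comp (continuous_stoneCechExtend _)) hψ ?_
    funext n
    simp only [Function.comp_apply, betaNatToBetaReal, stoneCechExtend_stoneCechUnit]
    exact congrFun hg n
  have h1 : ψ p = ψ q := by
    rw [← hext]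
    exact congrArg (stoneCechExtend g.continuous) hpq
  have h2 : φ p = φ q := congrArg Subtype.val h1
  have h3 : φ p = 0 := hφp rfl
  have h4 : φ q = 1 := hφq rfl
  linarith

/-- The space `Λ = βℝ \ (βℕ \ ℕ)`, as a subset of `βℝ`. -/
def lambdaSpace : Set (StoneCech ℝ) :=
  (Set.range betaNatToBetaReal \ Set.range (fun n : ℕ => stoneCechUnit (n : ℝ)))ᶜ

/-! The real numbers that are not natural numbers form a dense set in `Λ`. A sequence of them either
has a bounded subsequence or runs through a closed subset of `ℝ` missing `ℕ`, and the closure of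
such a set in `βℝ` avoids `βℕ`. So some subsequence lies in a compact subset of `Λ`
(`subseqRelCompact_nonNatPoints`). This property survives products, forces pseudocompactness, and
gives a Glicksberg-type extension of every function in `C(Λ × Λ)` to `βℝ × βℝ`
(`SubseqRelCompact.exists_prod_extension`).

Being rr-good passes from a dense subspace to a pseudocompact space to which bounded functions
extend (`IsRRGood.of_denseRange`). Hence `Λ` inherits it from the locally connected space `ℝ`, and
`Λ × Λ` cannot have it because `βℝ × βℝ` does not. There, an infimum of `|sin πx · sin πy|` and a
suitable perturbation would be 1 at `(n + 1/2, m + 1/2)` for `n ≤ m` and 0 for `m < n`; its two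
iterated limits would differ (`not_exists_separating_triangles`). -/

open Filter Topology

/-! ### Pseudocompactness and extension of functions from products -/

/-- Every sequence in `D` has a subsequence contained in a compact subset of the ambient space. -/
def SubseqRelCompact {X : Type*} [TopologicalSpace X] (D : Set X) : Prop :=
  ∀ x : ℕ → X, (∀ n, x n ∈ D) →
    ∃ φ : ℕ → ℕ, StrictMono φ ∧ ∃ K : Set X, IsCompact K ∧ ∀ n, x (φ n) ∈ K

theorem SubseqRelCompact.isPseudocompact {X : Type*} [TopologicalSpace X] {D : Set X}
    (h : SubseqRelCompact D) (hD : Dense D) : IsPseudocompact X := by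
  intro f
  by_contra! hf
  have h1 : ∀ n : ℕ, ∃ d ∈ D, (n : ℝ) < |f d| := by
    intro n
    obtain ⟨x, hx⟩ := hf n
    have ho : IsOpen {x : X | (n : ℝ) < |f x|} :=
      isOpen_lt continuous_const f.continuous.abs
    obtain ⟨d, hd, hdD⟩ := hD.inter_open_nonempty _ ho ⟨x, hx⟩
    exact ⟨d, hdD, hd⟩
  choose x hxD hx using h1
  obtain ⟨φ, hφ, K, hK, hmem⟩ := h x hxD
  obtain ⟨C, hC⟩ := hK.exists_bound_of_continuousOn f.continuous.continuousOn
  obtain ⟨n, hn⟩ := exists_nat_gt C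
  have h2 := hC _ (hmem n)
  have h3 := hx (φ n)
  have h4 : (n : ℝ) ≤ φ n := by exact_mod_cast hφ.id_le n
  rw [Real.norm_eq_abs] at h2
  linarith

theorem SubseqRelCompact.prod {X Y : Type*} [TopologicalSpace X] [TopologicalSpace Y]
    {D : Set X} {E : Set Y} (hD : SubseqRelCompact D) (hE : SubseqRelCompact E) :
    SubseqRelCompact (D ×ˢ E) := by
  intro z hz
  obtain ⟨φ, hφ, K, hK, hKm⟩ := hD (fun n => (z n).1) fun n => (hz n).1
  obtain ⟨ψ, hψ, L, hL, hLm⟩ := hE (fun n => (z (φ n)).2) fun n => (hz _).2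
  exact ⟨φ ∘ ψ, hφ.comp hψ, K ×ˢ L, hK.prod hL, fun n => ⟨hKm _, hLm n⟩⟩

/-- Points of the closure are approximated by values on `D` with errors tending to 0, so they
inherit convergent subsequences. -/
theorem SubseqRelCompact.isCompact_closure_range {X M : Type*} [TopologicalSpace X]
    [PseudoMetricSpace M] {D : Set X} (h : SubseqRelCompact D) (hD : Dense D)
    {Φ : X → M} (hΦ : Continuous Φ) : IsCompact (closure (Set.range Φ)) := by
  apply IsSeqCompact.isCompact
  intro z hz
  have h1 : ∀ n : ℕ, ∃ d ∈ D, dist (z n) (Φ d) < 1 / ((n : ℝ) + 1) := by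
    intro n
    obtain ⟨_, ⟨x, rfl⟩, hx⟩ := Metric.mem_closure_iff.1 (hz n) _ (Nat.one_div_pos_of_nat (n := n))
    have ho : IsOpen {x : X | dist (z n) (Φ x) < 1 / ((n : ℝ) + 1)} :=
      isOpen_lt (continuous_const.dist hΦ) continuous_const
    obtain ⟨d, hd, hdD⟩ := hD.inter_open_nonempty _ ho ⟨x, hx⟩
    exact ⟨d, hdD, hd⟩
  choose d hdD hd using h1
  obtain ⟨φ, hφ, K, hK, hmem⟩ := h d hdD
  obtain ⟨w, hw, ψ, hψ, hlim⟩ :=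
    (hK.image hΦ).isSeqCompact (x := fun n => Φ (d (φ n))) fun n => ⟨_, hmem n, rfl⟩
  refine ⟨w, subset_closure (Set.image_subset_range _ _ hw), φ ∘ ψ, hφ.comp hψ, ?_⟩
  rw [tendsto_iff_dist_tendsto_zero] at hlim ⊢
  have h0 : Tendsto (fun n => 1 / (((φ ∘ ψ) n : ℝ) + 1)) atTop (𝓝 0) :=
    tendsto_one_div_add_atTop_nhds_zero_nat.comp (hφ.comp hψ).tendsto_atTop
  refine squeeze_zero (fun _ => dist_nonneg) (fun n => ?_) (add_zero (0 : ℝ) ▸ h0.add hlim)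
  exact (dist_triangle _ (Φ (d (φ (ψ n)))) _).trans (add_le_add (hd _).le le_rfl)

/-- The uniform continuity in the second variable behind Glicksberg's theorem. -/
theorem SubseqRelCompact.eventually_forall_dist_le {X Y : Type*} [TopologicalSpace X]
    [TopologicalSpace Y] {D : Set X} {E : Set Y} (hD : SubseqRelCompact D) (hD' : Dense D)
    (hE : SubseqRelCompact E) (hE' : Dense E) (f : C(X × Y, ℝ)) (x₀ : X) {ε : ℝ} (hε : 0 < ε) :
    ∀ᶠ x in 𝓝 x₀, ∀ y, |f (x, y) - f (x₀, y)| ≤ ε := by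
  by_contra hcon
  let g : X × Y → ℝ := fun z => |f z - f (x₀, z.2)|
  have hg : Continuous g := by fun_prop
  -- Each new first coordinate is so near `x₀` that `g` is small against all earlier second
  -- coordinates, while `g` exceeds `ε` at the new point itself.
  obtain ⟨z, hz, hzr⟩ := exists_seq_of_forall_finset_exists
    (fun z : X × Y => z ∈ D ×ˢ E ∧ ε < g z) (fun z w => g (w.1, z.2) < ε / 2) (by
      intro s _
      have hs : ∀ᶠ x in 𝓝 x₀, ∀ z ∈ s, g (x, z.2) < ε / 2 := by
        rw [eventually_all_finset]
        intro z _
        have hc : Continuous fun x => g (x, z.2) := by fun_prop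
        refine (hc.tendsto x₀).eventually_lt_const ?_
        simpa [g] using half_pos hε
      obtain ⟨V, hV, hVo, hxV⟩ := eventually_nhds_iff.1 hs
      have : ∃ x ∈ V, ∃ y, ε < g (x, y) := by
        by_contra! hne
        exact hcon (Filter.mem_of_superset (hVo.mem_nhds hxV) fun x hx y => hne x hx y)
      obtain ⟨x, hx, y, hy⟩ := this
      have ho : IsOpen {z : X × Y | z.1 ∈ V ∧ ε < g z} :=
        (hVo.preimage continuous_fst).inter (isOpen_lt continuous_const hg)
      obtain ⟨w, hw, hwD⟩ := (hD'.prod hE').inter_open_nonempty _ ho ⟨(x, y), hx, hy⟩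
      exact ⟨w, ⟨hwD, hw.2⟩, hV _ hw.1⟩)
  obtain ⟨φ, hφ, K, hK, hmem⟩ := hD.prod hE z fun n => (hz n).1
  -- At a cluster point `w`, the diagonal limit gives `g w ≥ ε`; letting the first coordinate
  -- converge before the second gives `g w ≤ ε / 2`.
  obtain ⟨w, -, hw⟩ := hK.ultrafilter_le_nhds ((hyperfilter ℕ).map (z ∘ φ))
    (le_principal_iff.2 (univ_mem' hmem : z ∘ φ ⁻¹' K ∈ (hyperfilter ℕ : Filter ℕ)))
  have hw : Tendsto (z ∘ φ) (hyperfilter ℕ : Filter ℕ) (𝓝 w) := hw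
  have h1 : ε ≤ g w :=
    ge_of_tendsto ((hg.tendsto w).comp hw) (Eventually.of_forall fun n => (hz _).2.le)
  have h2 : ∀ n, g (w.1, (z (φ n)).2) ≤ ε / 2 := by
    intro n
    have hc : Continuous fun v : X × Y => g (v.1, (z (φ n)).2) := by fun_prop
    refine le_of_tendsto ((hc.tendsto w).comp hw) ?_
    have : ∀ᶠ m in (hyperfilter ℕ : Filter ℕ), n < m :=
      Nat.hyperfilter_le_atTop (eventually_gt_atTop n)
    filter_upwards [this] with m hm
    exact (hzr _ _ (hφ hm)).le
  have h3 : g w ≤ ε / 2 := by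
    have hc : Continuous fun v : X × Y => g (w.1, v.2) := by fun_prop
    exact le_of_tendsto ((hc.tendsto w).comp hw) (Eventually.of_forall h2)
  linarith

theorem exists_stoneCech_extension {X : Type*} [TopologicalSpace X] (f : C(X, ℝ)) {M : ℝ}
    (hM : ∀ x, |f x| ≤ M) : ∃ F : C(StoneCech X, ℝ), ∀ x, F (stoneCechUnit x) = f x := by
  have hc : Continuous fun x => (⟨f x, abs_le.1 (hM x)⟩ : Set.Icc (-M) M) :=
    f.continuous.subtype_mk _
  refine ⟨⟨fun p => (stoneCechExtend hc p).1,
    continuous_subtype_val.comp (continuous_stoneCechExtend hc)⟩, fun x => ?_⟩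
  simp [stoneCechExtend_stoneCechUnit]

/-- Currying turns `f` into a norm-continuous map from `X` to `C(βY)`. Its range has compact
closure, so it extends to `βX`; evaluation then undoes the currying. -/
theorem SubseqRelCompact.exists_prod_extension {X Y : Type*} [TopologicalSpace X]
    [TopologicalSpace Y] {D : Set X} {E : Set Y} (hD : SubseqRelCompact D) (hD' : Dense D)
    (hE : SubseqRelCompact E) (hE' : Dense E) (f : C(X × Y, ℝ)) :
    ∃ F : C(StoneCech X × StoneCech Y, ℝ),
      ∀ x y, F (stoneCechUnit x, stoneCechUnit y) = f (x, y) := by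
  obtain ⟨M, hM⟩ := (hD.prod hE).isPseudocompact (hD'.prod hE') f
  have hsec : ∀ x, ∃ F : C(StoneCech Y, ℝ), ∀ y, F (stoneCechUnit y) = f (x, y) := fun x =>
    exists_stoneCech_extension ⟨fun y => f (x, y), by fun_prop⟩ fun y => hM (x, y)
  choose Φ hΦ using hsec
  have hcont : Continuous Φ := by
    refine continuous_iff_continuousAt.2 fun x₀ => Metric.tendsto_nhds.2 fun ε hε => ?_
    filter_upwards [hD.eventually_forall_dist_le hD' hE hE' f x₀ (half_pos hε)] with x hx
    refine lt_of_le_of_lt ((ContinuousMap.dist_le (half_pos hε).le).2 fun q => ?_) (half_lt_self hε)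
    refine denseRange_stoneCechUnit.induction_on (p := fun q => dist (Φ x q) (Φ x₀ q) ≤ ε / 2) q
      (isClosed_le (by fun_prop) continuous_const) fun y => ?_
    rw [hΦ, hΦ]
    exact hx y
  have hK := hD.isCompact_closure_range hD' hcont
  have : CompactSpace (closure (Set.range Φ)) := isCompact_iff_compactSpace.1 hK
  have hc : Continuous fun x => (⟨Φ x, subset_closure ⟨x, rfl⟩⟩ : closure (Set.range Φ)) :=
    hcont.subtype_mk _
  have hc' : Continuous fun p => (stoneCechExtend hc p).1 :=
    continuous_subtype_val.comp (continuous_stoneCechExtend hc)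
  refine ⟨⟨fun z => (stoneCechExtend hc z.1).1 z.2,
    (hc'.comp continuous_fst).eval continuous_snd⟩, fun x y => ?_⟩
  simp [stoneCechExtend_stoneCechUnit, hΦ]

/-! ### Recognising the Stone–Čech compactification -/

/-- A compact Hausdorff space in which `X` is dense and to which the continuous functions on `X`
extend is the Stone–Čech compactification of `X`. -/
theorem exists_homeomorph_stoneCech {X Z : Type*} [TopologicalSpace X] [TopologicalSpace Z]
    [CompactSpace Z] [T2Space Z] {i : X → Z} (hi : Continuous i) (hd : DenseRange i)
    (hext : ∀ f : C(X, ℝ), (∃ M, ∀ x, |f x| ≤ M) → ∃ F : C(Z, ℝ), ∀ x, F (i x) = f x) :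
    ∃ e : StoneCech X ≃ₜ Z, ∀ x, e (stoneCechUnit x) = i x := by
  have hc := continuous_stoneCechExtend hi
  have hu : ∀ x, stoneCechExtend hi (stoneCechUnit x) = i x := stoneCechExtend_stoneCechUnit hi
  have hsurj : Function.Surjective (stoneCechExtend hi) := by
    have hcl : IsClosed (Set.range (stoneCechExtend hi)) := (isCompact_range hc).isClosed
    rw [← Set.range_eq_univ, ← hcl.closure_eq]
    refine (hd.mono ?_).closure_eq
    rintro _ ⟨x, rfl⟩
    exact ⟨_, hu x⟩
  have hinj : Function.Injective (stoneCechExtend hi) := by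
    intro p q hpq
    by_contra hne
    obtain ⟨φ, hφp, hφq, hφ⟩ := exists_continuous_zero_one_of_isClosed
      (isClosed_singleton (x := p)) (isClosed_singleton (x := q))
      (Set.disjoint_singleton.2 hne)
    obtain ⟨F, hF⟩ := hext ⟨φ ∘ stoneCechUnit, φ.continuous.comp continuous_stoneCechUnit⟩
      ⟨1, fun x => abs_le.2 ⟨neg_one_lt_zero.le.trans (hφ _).1, (hφ _).2⟩⟩
    have hFφ : F ∘ stoneCechExtend hi = φ := by
      refine stoneCech_hom_ext (F.continuous.comp hc) φ.continuous ?_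
      funext x
      simp [hu, hF]
    have h1 : φ p = φ q := by
      rw [← hFφ]
      exact congrArg F hpq
    have h2 : φ p = 0 := hφp rfl
    have h3 : φ q = 1 := hφq rfl
    linarith
  exact ⟨(hc.isClosedEmbedding hinj).isEmbedding.toHomeomorphOfSurjective hsurj, hu⟩

/-! ### The reduced ring order on rings of continuous functions -/

theorem rrLe_iff {X : Type*} [TopologicalSpace X] {f g : C(X, ℝ)} :
    RRLe f g ↔ ∀ x, f x ≠ 0 → f x = g x := by
  unfold RRLe
  constructor
  · intro h x hx
    have := DFunLike.congr_fun h x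
    simp only [ContinuousMap.mul_apply, sq] at this
    exact mul_left_cancel₀ hx this
  · intro h
    ext x
    simp only [ContinuousMap.mul_apply, sq]
    rcases eq_or_ne (f x) 0 with h0 | h0
    · simp [h0]
    · rw [h x h0]

theorem RRLe.abs_le {X : Type*} [TopologicalSpace X] {f g : C(X, ℝ)} (h : RRLe f g) (x : X) :
    |f x| ≤ |g x| := by
  rcases eq_or_ne (f x) 0 with h0 | h0
  · simp [h0]
  · rw [rrLe_iff.1 h x h0]

theorem RRLe.comp {X Y : Type*} [TopologicalSpace X] [TopologicalSpace Y] {f g : C(Y, ℝ)}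
    (h : RRLe f g) (i : C(X, Y)) : RRLe (f.comp i) (g.comp i) :=
  rrLe_iff.2 fun x => rrLe_iff.1 h (i x)

theorem RRLe.of_comp {X Y : Type*} [TopologicalSpace X] [TopologicalSpace Y] {f g : C(Y, ℝ)}
    {i : C(X, Y)} (hi : DenseRange i) (h : RRLe (f.comp i) (g.comp i)) : RRLe f g := by
  apply DFunLike.coe_injective
  refine hi.equalizer (ContinuousMap.continuous _) (ContinuousMap.continuous _) ?_
  funext x
  exact DFunLike.congr_fun h x

/-- The property of being rr-good passes from a dense subspace to a pseudocompact space to which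
bounded functions extend. -/
theorem IsRRGood.of_denseRange {X Y : Type*} [TopologicalSpace X] [TopologicalSpace Y]
    (i : C(X, Y)) (hi : DenseRange i) (hY : IsPseudocompact Y)
    (hext : ∀ f : C(X, ℝ), (∃ M, ∀ x, |f x| ≤ M) → ∃ F : C(Y, ℝ), ∀ x, F (i x) = f x)
    (h : IsRRGood X) : IsRRGood Y := by
  intro r s
  obtain ⟨t, htr, hts, ht⟩ := h (r.comp i) (s.comp i)
  obtain ⟨M, hM⟩ := hY r
  obtain ⟨T, hT⟩ := hext t ⟨M, fun x => (htr.abs_le x).trans (hM _)⟩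
  obtain rfl : T.comp i = t := ContinuousMap.ext hT
  exact ⟨T, htr.of_comp hi, hts.of_comp hi,
    fun u hur hus => (ht _ (hur.comp i) (hus.comp i)).of_comp hi⟩

/-- The infimum equals `f` on those components of `{f ≠ 0}` where `f = g` throughout, and 0
elsewhere. It is continuous because these components are open. -/
theorem isRRGood_of_locallyConnectedSpace (X : Type*) [TopologicalSpace X]
    [LocallyConnectedSpace X] : IsRRGood X := by
  classical
  intro f g
  let C : Set X := {x | f x ≠ 0}
  have hC : IsOpen C := isOpen_ne_fun f.continuous continuous_const
  let P : X → Prop := fun x => ∀ y ∈ connectedComponentIn C x, f y = g y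
  have hPc : ∀ x ∈ C, ∀ᶠ y in 𝓝 x, P y ↔ P x := by
    intro x hx
    have hmem := hC.connectedComponentIn.mem_nhds (mem_connectedComponentIn hx)
    filter_upwards [hmem] with y hy
    simp only [P, connectedComponentIn_eq hy]
  let t : X → ℝ := fun x => if P x then f x else 0
  have ht : Continuous t := by
    refine continuous_iff_continuousAt.2 fun x => ?_
    by_cases hx : x ∈ C
    · by_cases hP : P x
      · refine f.continuous.continuousAt.congr ?_
        filter_upwards [hPc x hx] with y hy
        simp [t, hy, hP]
      · refine continuousAt_const (y := (0 : ℝ)).congr ?_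
        filter_upwards [hPc x hx] with y hy
        simp [t, hy, hP]
    · have hx0 : f x = 0 := not_not.1 hx
      have htx : t x = 0 := by simp [t, hx0]
      have hf : Tendsto (fun y => ‖f y‖) (𝓝 x) (𝓝 0) := by
        simpa [hx0] using (f.continuous.norm.tendsto x)
      rw [ContinuousAt, htx]
      refine squeeze_zero_norm (fun y => ?_) hf
      by_cases hP : P y <;> simp [t, hP]
  refine ⟨⟨t, ht⟩, rrLe_iff.2 ?_, rrLe_iff.2 ?_, fun u huf hug => rrLe_iff.2 ?_⟩
  · intro x hx
    by_cases hP : P x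
    · simp [t, hP]
    · simp [t, hP] at hx
  · intro x hx
    by_cases hP : P x
    · have hfx : x ∈ C := by simpa [t, hP, C] using hx
      simpa [t, hP] using hP x (mem_connectedComponentIn hfx)
    · simp [t, hP] at hx
  · intro x hx
    have hux : u x = f x := rrLe_iff.1 huf x hx
    have hxC : x ∈ C := fun h => hx (hux.trans h)
    suffices hP : P x by simp [t, hP, hux]
    have hsub : connectedComponentIn C x ⊆ {y | u y ≠ 0} := by
      have hpre := isPreconnected_connectedComponentIn (F := C) (x := x)
      -- On the component, `u` is either 0 or equal to `f ≠ 0`, so `{u ≠ 0}` and `{u ≠ f}` split it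
      -- into disjoint open pieces.
      refine hpre.subset_left_of_subset_union (v := {y | u y ≠ f y})
        (isOpen_ne_fun u.continuous continuous_const)
        (isOpen_ne_fun u.continuous f.continuous)
        (Set.disjoint_left.2 fun y hy hy' => hy' (rrLe_iff.1 huf y hy)) (fun y hy => ?_)
        ⟨x, mem_connectedComponentIn hxC, hx⟩
      by_cases h0 : u y = 0
      · exact Or.inr fun h => connectedComponentIn_subset _ _ hy (h.symm.trans h0)
      · exact Or.inl h0
    intro y hy
    have := hsub hy
    exact (rrLe_iff.1 huf y this).symm.trans (rrLe_iff.1 hug y this)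

/-! ### Topology of `Λ` -/

theorem closure_image_subset_compl_range_betaNatToBetaReal {S : Set ℝ} (hS : IsClosed S)
    (hSN : ∀ n : ℕ, (n : ℝ) ∉ S) :
    closure (stoneCechUnit '' S) ⊆ (Set.range betaNatToBetaReal)ᶜ := by
  obtain ⟨φ, hφN, hφS, hφ⟩ := exists_continuous_zero_one_of_isClosed
    Nat.isClosedEmbedding_coe_real.isClosed_range hS
    (Set.disjoint_left.2 (by rintro _ ⟨n, rfl⟩; exact hSN n))
  obtain ⟨F, hF⟩ := exists_stoneCech_extension φ (M := 1)
    fun x => abs_le.2 ⟨neg_one_lt_zero.le.trans (hφ _).1, (hφ _).2⟩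
  have h1 : ∀ p ∈ closure (stoneCechUnit '' S), F p = 1 := by
    refine fun p hp => closure_minimal ?_ (isClosed_eq F.continuous continuous_const) hp
    rintro _ ⟨x, hx, rfl⟩
    exact (hF x).trans (hφS hx)
  have h0 : F ∘ betaNatToBetaReal = fun _ => 0 := by
    refine stoneCech_hom_ext (F.continuous.comp isClosedEmbedding_betaNatToBetaReal.continuous)
      continuous_const ?_
    funext n
    simp only [Function.comp_apply, betaNatToBetaReal, stoneCechExtend_stoneCechUnit]
    exact (hF _).trans (hφN ⟨n, rfl⟩)
  rintro _ hp ⟨q, rfl⟩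
  have := congrFun h0 q
  simp [h1 _ hp] at this

theorem closure_image_subset_lambdaSpace {S : Set ℝ} (hS : IsClosed S)
    (hSN : ∀ n : ℕ, (n : ℝ) ∉ S) : closure (stoneCechUnit '' S) ⊆ lambdaSpace :=
  (closure_image_subset_compl_range_betaNatToBetaReal hS hSN).trans
    (Set.compl_subset_compl.2 Set.sdiff_subset)

theorem stoneCechUnit_mem_lambdaSpace (x : ℝ) : stoneCechUnit x ∈ lambdaSpace := by
  by_cases hx : ∃ n : ℕ, (n : ℝ) = x
  · obtain ⟨n, rfl⟩ := hx
    exact fun h => h.2 ⟨n, rfl⟩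
  · refine closure_image_subset_lambdaSpace (isClosed_singleton (x := x))
      (fun n hn => hx ⟨n, hn⟩) (subset_closure ⟨x, rfl, rfl⟩)

/-- The inclusion of the real line in `Λ`. -/
noncomputable def realToLambda : C(ℝ, lambdaSpace) :=
  ⟨fun x => ⟨stoneCechUnit x, stoneCechUnit_mem_lambdaSpace x⟩,
    continuous_stoneCechUnit.subtype_mk _⟩

theorem denseRange_realToLambda : DenseRange realToLambda := by
  refine Topology.IsInducing.subtypeVal.dense_iff.2 fun p => ?_
  rw [← Set.range_comp]
  exact denseRange_stoneCechUnit (p : StoneCech ℝ)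

theorem denseRange_lambdaSpace_val : DenseRange (Subtype.val : lambdaSpace → StoneCech ℝ) :=
  denseRange_stoneCechUnit.mono (by
    rintro _ ⟨x, rfl⟩
    exact ⟨realToLambda x, rfl⟩)

/-- Compactness would force `Λ = βℝ`. But the extension of `(1 + x²)⁻¹` vanishes at a free
ultrafilter limit of the naturals, which therefore is not a natural number. -/
theorem not_compactSpace_lambdaSpace : ¬ CompactSpace lambdaSpace := by
  intro hc
  have hcl : IsClosed lambdaSpace := (isCompact_iff_compactSpace.2 hc).isClosed
  have huniv : ∀ p, p ∈ lambdaSpace := by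
    intro p
    have := denseRange_lambdaSpace_val p
    rwa [Subtype.range_coe, hcl.closure_eq] at this
  let f : C(ℝ, ℝ) := ⟨fun x => (1 + x ^ 2)⁻¹, by
    exact Continuous.inv₀ (by fun_prop) fun x => by positivity⟩
  obtain ⟨F, hF⟩ := exists_stoneCech_extension f (M := 1) fun x => by
    rw [abs_of_pos (by simp only [f, ContinuousMap.coe_mk]; positivity)]
    exact inv_le_one_of_one_le₀ (by nlinarith)
  obtain ⟨q, hq⟩ : ∃ q, Tendsto (stoneCechUnit : ℕ → StoneCech ℕ) (hyperfilter ℕ) (𝓝 q) := by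
    obtain ⟨q, -, hq⟩ := isCompact_univ.ultrafilter_le_nhds
      ((hyperfilter ℕ).map (stoneCechUnit : ℕ → StoneCech ℕ)) (by simp)
    exact ⟨q, hq⟩
  have hG : Tendsto (fun n : ℕ => F (stoneCechUnit (n : ℝ))) (hyperfilter ℕ)
      (𝓝 (F (betaNatToBetaReal q))) := by
    have := ((F.continuous.comp isClosedEmbedding_betaNatToBetaReal.continuous).tendsto q).comp hq
    refine this.congr fun n => ?_
    simp [betaNatToBetaReal, stoneCechExtend_stoneCechUnit]
  have h0 : Tendsto (fun n : ℕ => F (stoneCechUnit (n : ℝ))) (hyperfilter ℕ) (𝓝 0) := by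
    have : Tendsto (fun n : ℕ => (1 + (n : ℝ) ^ 2)⁻¹) atTop (𝓝 0) :=
      (tendsto_atTop_add_const_left _ _
        ((tendsto_pow_atTop two_ne_zero).comp tendsto_natCast_atTop_atTop)).inv_tendsto_atTop
    exact (this.mono_left Nat.hyperfilter_le_atTop).congr fun n => (hF n).symm
  have hzero := tendsto_nhds_unique hG h0
  obtain ⟨n, hn⟩ : betaNatToBetaReal q ∈ Set.range (fun n : ℕ => stoneCechUnit (n : ℝ)) := by
    by_contra hn
    exact huniv _ ⟨⟨q, rfl⟩, hn⟩
  rw [← hn] at hzero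
  have : f n = 0 := (hF n).symm.trans hzero
  have hpos : 0 < f n := by simp only [f, ContinuousMap.coe_mk]; positivity
  linarith

/-- The points of `Λ` given by the real numbers that are not natural numbers. -/
def nonNatPoints : Set lambdaSpace := realToLambda '' (Set.range (Nat.cast : ℕ → ℝ))ᶜ

theorem dense_nonNatPoints : Dense nonNatPoints :=
  denseRange_realToLambda.dense_image realToLambda.continuous
    ((Set.countable_range _).dense_compl ℝ)

theorem isCompact_preimage_closure {S : Set ℝ} (hS : IsClosed S) (hSN : ∀ n : ℕ, (n : ℝ) ∉ S) :
    IsCompact (Subtype.val ⁻¹' closure (stoneCechUnit '' S) : Set lambdaSpace) := by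
  rw [Topology.IsInducing.subtypeVal.isCompact_iff, Subtype.image_preimage_coe,
    Set.inter_eq_right.2 (closure_image_subset_lambdaSpace hS hSN)]
  exact isClosed_closure.isCompact

theorem subseqRelCompact_nonNatPoints : SubseqRelCompact nonNatPoints := by
  intro z hz
  choose x hxN hx using hz
  by_cases hfr : ∃ R : ℝ, ∃ᶠ n in atTop, x n ∈ Metric.closedBall (0 : ℝ) R
  · obtain ⟨R, hR⟩ := hfr
    obtain ⟨φ, hφ, hm⟩ := extraction_of_frequently_atTop hR
    refine ⟨φ, hφ, realToLambda '' Metric.closedBall (0 : ℝ) R,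
      (isCompact_closedBall _ _).image realToLambda.continuous, fun n => ⟨_, hm n, hx _⟩⟩
  · push Not at hfr
    have hlim : Tendsto x atTop (cocompact ℝ) := by
      rw [← Metric.cobounded_eq_cocompact,
        (Metric.hasBasis_cobounded_compl_closedBall (0 : ℝ)).tendsto_right_iff]
      intro R _
      exact hfr R
    -- With no bounded subsequence, `x` is a proper map from discrete `ℕ`, hence closed.
    have hcl : IsClosed (Set.range x) := by
      refine (isProperMap_iff_tendsto_cocompact.2
        ⟨continuous_of_discreteTopology, ?_⟩).isClosedMap.isClosed_range
      rwa [cocompact_eq_cofinite, Nat.cofinite_eq_atTop]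
    refine ⟨id, strictMono_id, _, isCompact_preimage_closure hcl ?_, fun n => ?_⟩
    · rintro n ⟨m, hm⟩
      exact hxN m ⟨n, hm.symm⟩
    · refine subset_closure ⟨x n, ⟨n, rfl⟩, ?_⟩
      exact congrArg Subtype.val (hx n)

/-! ### Failure of rr-goodness on `βℝ × βℝ` -/

/-- The function `|sin (π x)|` restricted to `[n, n + 1]` and extended by zero. -/
noncomputable def sineBump (n : ℕ) : C(ℝ, ℝ) :=
  ⟨fun x => |Real.sin (Real.pi * max (n : ℝ) (min (n + 1) x))|, by fun_prop⟩

/-- The function `|sin (π x)|`. -/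
noncomputable def absSine : C(ℝ, ℝ) := ⟨fun x => |Real.sin (Real.pi * x)|, by fun_prop⟩

/-- The function `|sin (π x)|` truncated to zero above `n`. -/
noncomputable def absSineBelow (n : ℕ) : C(ℝ, ℝ) :=
  ⟨fun x => |Real.sin (Real.pi * min (n : ℝ) x)|, by fun_prop⟩

theorem sin_pi_mul_natCast (n : ℕ) : Real.sin (Real.pi * n) = 0 := by
  rw [mul_comm, Real.sin_nat_mul_pi]

theorem abs_sin_pi_mul_add_half (n : ℕ) : |Real.sin (Real.pi * (n + 1 / 2))| = 1 := by
  rw [show Real.pi * (n + 1 / 2) = Real.pi / 2 + n * Real.pi by ring, Real.sin_add_nat_mul_pi]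
  simp

theorem sineBump_of_le {n : ℕ} {x : ℝ} (h : x ≤ n) : sineBump n x = 0 := by
  have : max (n : ℝ) (min (n + 1) x) = n := max_eq_left ((min_le_right _ _).trans h)
  simp only [sineBump, ContinuousMap.coe_mk, this, sin_pi_mul_natCast, abs_zero]

theorem sineBump_of_ge {n : ℕ} {x : ℝ} (h : (n : ℝ) + 1 ≤ x) : sineBump n x = 0 := by
  have : max (n : ℝ) (min (n + 1) x) = (n + 1 : ℕ) := by
    rw [min_eq_left h, max_eq_right (by linarith)]
    simp
  simp only [sineBump, ContinuousMap.coe_mk, this, sin_pi_mul_natCast, abs_zero]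

theorem sineBump_of_mem {n : ℕ} {x : ℝ} (h₁ : n ≤ x) (h₂ : x ≤ n + 1) :
    sineBump n x = absSine x := by
  simp only [sineBump, absSine, ContinuousMap.coe_mk, min_eq_right h₂, max_eq_right h₁]

theorem sineBump_mul_self (n : ℕ) (x : ℝ) :
    sineBump n x * sineBump n x = sineBump n x * absSine x := by
  rcases le_total x n with h | h
  · simp [sineBump_of_le h]
  rcases le_total x (n + 1) with h' | h'
  · rw [sineBump_of_mem h h']
  · simp [sineBump_of_ge h']

theorem sineBump_mul_of_lt {m n : ℕ} (hmn : m < n) (x : ℝ) : sineBump m x * sineBump n x = 0 := by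
  rcases le_total x n with h | h
  · simp [sineBump_of_le h]
  · have : (m : ℝ) + 1 ≤ n := by exact_mod_cast hmn
    simp [sineBump_of_ge (this.trans h)]

theorem sineBump_mul_of_ne {m n : ℕ} (hmn : m ≠ n) (x : ℝ) : sineBump m x * sineBump n x = 0 := by
  rcases hmn.lt_or_gt with h | h
  · exact sineBump_mul_of_lt h x
  · rw [mul_comm, sineBump_mul_of_lt h x]

theorem absSineBelow_mul_sineBump {m n : ℕ} (hnm : n ≤ m) (x : ℝ) :
    absSineBelow n x * sineBump m x = 0 := by
  have hc : (n : ℝ) ≤ m := by exact_mod_cast hnm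
  rcases le_total x m with h | h
  · simp [sineBump_of_le h]
  · have : absSineBelow n x = 0 := by
      simp only [absSineBelow, ContinuousMap.coe_mk, min_eq_left (hc.trans h),
        sin_pi_mul_natCast, abs_zero]
    simp [this]

theorem sineBump_center (n : ℕ) : sineBump n ((n : ℝ) + 1 / 2) = 1 := by
  rw [sineBump_of_mem (by linarith) (by linarith)]
  exact abs_sin_pi_mul_add_half n

theorem absSineBelow_center {m n : ℕ} (h : m < n) : absSineBelow n ((m : ℝ) + 1 / 2) = 1 := by
  have hc : (m : ℝ) + 1 ≤ n := by exact_mod_cast h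
  simp only [absSineBelow, ContinuousMap.coe_mk]
  rw [min_eq_right (by linarith)]
  exact abs_sin_pi_mul_add_half m

theorem abs_abs_sin_le_one (x : ℝ) : |(|Real.sin x|)| ≤ 1 := by
  rw [abs_abs]
  exact Real.abs_sin_le_one x

theorem mul_eq_mul_of_stoneCechUnit {X : Type*} [TopologicalSpace X]
    {F G F' G' : C(StoneCech X, ℝ)}
    (h : ∀ x, F (stoneCechUnit x) * G (stoneCechUnit x) = F' (stoneCechUnit x) * G' (stoneCechUnit x))
    (p : StoneCech X) : F p * G p = F' p * G' p :=
  denseRange_stoneCechUnit.induction_on (p := fun p => F p * G p = F' p * G' p) p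
    (isClosed_eq (by fun_prop) (by fun_prop)) h

theorem mul_eq_zero_of_stoneCechUnit {X : Type*} [TopologicalSpace X] {F G : C(StoneCech X, ℝ)}
    (h : ∀ x, F (stoneCechUnit x) * G (stoneCechUnit x) = 0) (p : StoneCech X) : F p * G p = 0 := by
  simpa using mul_eq_mul_of_stoneCechUnit (F' := 0) (G' := 0) (by simpa using h) p

/-- A continuous function on the square of a compact space cannot separate the two triangles
of the square of a sequence. -/
theorem not_exists_separating_triangles {X : Type*} [TopologicalSpace X] [CompactSpace X]
    (c : ℕ → X) (t : C(X × X, ℝ)) (h₁ : ∀ n m, n ≤ m → t (c n, c m) = 1)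
    (h₀ : ∀ n m, m < n → t (c n, c m) = 0) : False := by
  obtain ⟨p, -, hp⟩ := isCompact_univ.ultrafilter_le_nhds ((hyperfilter ℕ).map c) (by simp)
  have hp : Tendsto c (hyperfilter ℕ) (𝓝 p) := hp
  have hr : ∀ x, Tendsto (fun m => t (x, c m)) (hyperfilter ℕ) (𝓝 (t (x, p))) := fun x =>
    ((show Continuous fun y => t (x, y) by fun_prop).tendsto p).comp hp
  have hl : ∀ x, Tendsto (fun n => t (c n, x)) (hyperfilter ℕ) (𝓝 (t (p, x))) := fun x =>
    ((show Continuous fun y => t (y, x) by fun_prop).tendsto p).comp hp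
  -- Both iterated limits along the ultrafilter equal `t (p, p)`, yet one is 1 and the other 0.
  have e₁ : ∀ n, t (c n, p) = 1 := fun n =>
    tendsto_nhds_unique_of_eventuallyEq (hr _) tendsto_const_nhds
      ((eventually_ge_atTop n).filter_mono Nat.hyperfilter_le_atTop |>.mono fun m hm => h₁ n m hm)
  have e₀ : ∀ m, t (p, c m) = 0 := fun m =>
    tendsto_nhds_unique_of_eventuallyEq (hl _) tendsto_const_nhds
      ((eventually_gt_atTop m).filter_mono Nat.hyperfilter_le_atTop |>.mono fun n hn => h₀ n m hn)
  have h1 := tendsto_nhds_unique_of_eventuallyEq (hl p) tendsto_const_nhds (Eventually.of_forall e₁)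
  have h0 := tendsto_nhds_unique_of_eventuallyEq (hr p) tendsto_const_nhds (Eventually.of_forall e₀)
  exact one_ne_zero (h1.symm.trans h0)

/-- The pair is `f` and `f + h`, which agree exactly where `h` vanishes. The function `h` is built
to kill the product bumps `a n ⊗ a m` with `n ≤ m`, but to be nonzero at their centers when `m < n`.
-/
theorem not_isRRGood_stoneCech_real_prod : ¬ IsRRGood (StoneCech ℝ × StoneCech ℝ) := by
  intro hgood
  obtain ⟨A, hA⟩ := exists_stoneCech_extension absSine fun x => abs_abs_sin_le_one _
  choose a ha using fun n =>
    exists_stoneCech_extension (sineBump n) fun x => abs_abs_sin_le_one _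
  choose B hB using fun n =>
    exists_stoneCech_extension (absSineBelow n) fun x => abs_abs_sin_le_one _
  have haA : ∀ n p, a n p * a n p = a n p * A p := fun n =>
    mul_eq_mul_of_stoneCechUnit fun x => by simpa [ha, hA] using sineBump_mul_self n x
  have haa : ∀ m n, m ≠ n → ∀ p, a m p * a n p = 0 := fun m n hmn =>
    mul_eq_zero_of_stoneCechUnit fun x => by simpa [ha] using sineBump_mul_of_ne hmn x
  have hBa : ∀ n m, n ≤ m → ∀ p, B n p * a m p = 0 := fun n m hnm =>
    mul_eq_zero_of_stoneCechUnit fun x => by simpa [ha, hB] using absSineBelow_mul_sineBump hnm x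
  have ha1 : ∀ n p, |a n p| ≤ 1 := fun n p =>
    denseRange_stoneCechUnit.induction_on (p := fun p => |a n p| ≤ 1) p
      (isClosed_le (by fun_prop) continuous_const)
      fun x => by rw [ha]; exact abs_abs_sin_le_one _
  have hB1 : ∀ n p, |B n p| ≤ 1 := fun n p =>
    denseRange_stoneCechUnit.induction_on (p := fun p => |B n p| ≤ 1) p
      (isClosed_le (by fun_prop) continuous_const)
      fun x => by rw [hB]; exact abs_abs_sin_le_one _
  let c : ℕ → StoneCech ℝ := fun n => stoneCechUnit ((n : ℝ) + 1 / 2)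
  have hac : ∀ n, a n (c n) = 1 := fun n => (ha _ _).trans (sineBump_center n)
  let f : C(StoneCech ℝ × StoneCech ℝ, ℝ) := ⟨fun z => A z.1 * A z.2, by fun_prop⟩
  have hh : Continuous fun z : StoneCech ℝ × StoneCech ℝ =>
      ∑' n : ℕ, (1 / 2 : ℝ) ^ n * (a n z.1 * B n z.2) := by
    refine continuous_tsum (fun n => by fun_prop) summable_geometric_two fun n z => ?_
    rw [norm_mul, norm_mul, Real.norm_of_nonneg (by positivity)]
    exact mul_le_of_le_one_right (by positivity)
      (mul_le_one₀ (ha1 _ _) (norm_nonneg _) (hB1 _ _))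
  let h : C(StoneCech ℝ × StoneCech ℝ, ℝ) := ⟨_, hh⟩
  -- The bumps are pairwise orthogonal, so multiplying by `a n` isolates one term of the series.
  have hmul : ∀ n z, a n z.1 * h z = (1 / 2 : ℝ) ^ n * (a n z.1 * a n z.1 * B n z.2) := by
    intro n z
    simp only [h, ContinuousMap.coe_mk]
    rw [← tsum_mul_left, tsum_eq_single n]
    · ring
    · intro k hk
      linear_combination (1 / 2 : ℝ) ^ k * B k z.2 * haa n k hk.symm z.1
  obtain ⟨t, htf, htg, ht⟩ := hgood f (f + h)
  refine not_exists_separating_triangles c t (fun n m hnm => ?_) fun n m hmn => ?_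
  -- This product bump is a common lower bound with value 1 at its center, so it pins `t` there.
  · let u : C(StoneCech ℝ × StoneCech ℝ, ℝ) := ⟨fun z => a n z.1 * a m z.2, by fun_prop⟩
    have huf : RRLe u f := by
      ext z
      change (a n z.1 * a m z.2) ^ 2 = a n z.1 * a m z.2 * (A z.1 * A z.2)
      linear_combination (a m z.2) ^ 2 * haA n z.1 + a n z.1 * A z.1 * haA m z.2
    have huh : ∀ z, u z * h z = 0 := by
      intro z
      change a n z.1 * a m z.2 * h z = 0
      linear_combination a m z.2 * hmul n z +
        (1 / 2 : ℝ) ^ n * (a n z.1 * a n z.1) * hBa n m hnm z.2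
    have hug : RRLe u (f + h) := by
      ext z
      have := DFunLike.congr_fun huf z
      change u z ^ 2 = u z * (f z + h z)
      change u z ^ 2 = u z * f z at this
      rw [this, mul_add, huh, add_zero]
    have hu1 : u (c n, c m) = 1 := by
      change a n (c n) * a m (c m) = 1
      rw [hac, hac, one_mul]
    rw [← rrLe_iff.1 (ht u huf hug) (c n, c m) (by simp [hu1]), hu1]
  -- A nonzero value of `t` would force `h = 0` at a point where `h` is `(1 / 2) ^ n`.
  · by_contra h0
    have e := (rrLe_iff.1 htf _ h0).symm.trans (rrLe_iff.1 htg _ h0)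
    have hz : h (c n, c m) = 0 := by simpa using e
    have hBc : B n (c m) = 1 := (hB _ _).trans (absSineBelow_center hmn)
    have := hmul n (c n, c m)
    simp [hac, hBc, hz, eq_comm (a := (0 : ℝ))] at this

/-! ### Conclusions for `Λ` and `Λ × Λ` -/

theorem isPseudocompact_of_compactSpace (X : Type*) [TopologicalSpace X] [CompactSpace X] :
    IsPseudocompact X := fun f => ⟨‖f‖, f.norm_coe_le_norm⟩

theorem isPseudocompact_lambdaSpace : IsPseudocompact lambdaSpace :=
  subseqRelCompact_nonNatPoints.isPseudocompact dense_nonNatPoints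

theorem isPseudocompact_lambdaSpace_prod : IsPseudocompact (lambdaSpace × lambdaSpace) :=
  (subseqRelCompact_nonNatPoints.prod subseqRelCompact_nonNatPoints).isPseudocompact
    (dense_nonNatPoints.prod dense_nonNatPoints)

theorem connectedSpace_lambdaSpace : ConnectedSpace lambdaSpace := by
  have h := (isConnected_range realToLambda.continuous).closure
  rw [denseRange_realToLambda.closure_eq] at h
  exact connectedSpace_iff_univ.2 h

theorem isRRGood_lambdaSpace : IsRRGood lambdaSpace := by
  refine (isRRGood_of_locallyConnectedSpace ℝ).of_denseRange realToLambda denseRange_realToLambda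
    isPseudocompact_lambdaSpace ?_
  rintro f ⟨M, hM⟩
  obtain ⟨F, hF⟩ := exists_stoneCech_extension f hM
  exact ⟨⟨fun p => F p, by fun_prop⟩, hF⟩

theorem exists_homeomorph_stoneCech_lambdaSpace : ∃ e : StoneCech lambdaSpace ≃ₜ StoneCech ℝ,
    ∀ x : lambdaSpace, e (stoneCechUnit x) = (x : StoneCech ℝ) := by
  refine exists_homeomorph_stoneCech continuous_subtype_val denseRange_lambdaSpace_val ?_
  rintro f ⟨M, hM⟩
  obtain ⟨F, hF⟩ := exists_stoneCech_extension (f.comp realToLambda) fun x => hM _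
  refine ⟨F, congrFun ?_⟩
  exact denseRange_realToLambda.equalizer (F.continuous.comp continuous_subtype_val)
    f.continuous (funext hF)

theorem exists_extension_of_lambdaSpace_prod (f : C(lambdaSpace × lambdaSpace, ℝ)) :
    ∃ F : C(StoneCech ℝ × StoneCech ℝ, ℝ), ∀ p, F (Prod.map Subtype.val Subtype.val p) = f p := by
  obtain ⟨e, he⟩ := exists_homeomorph_stoneCech_lambdaSpace
  obtain ⟨F, hF⟩ := subseqRelCompact_nonNatPoints.exists_prod_extension dense_nonNatPoints
    subseqRelCompact_nonNatPoints dense_nonNatPoints f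
  refine ⟨F.comp ⟨Prod.map e.symm e.symm, by fun_prop⟩, fun p => ?_⟩
  have hs : ∀ x : lambdaSpace, e.symm x = stoneCechUnit x := fun x =>
    (e.symm_apply_eq).2 (he x).symm
  simp [Prod.map, hs, hF]

theorem not_isRRGood_lambdaSpace_prod : ¬ IsRRGood (lambdaSpace × lambdaSpace) := fun h =>
  not_isRRGood_stoneCech_real_prod <| h.of_denseRange
    ⟨Prod.map Subtype.val Subtype.val, by fun_prop⟩
    (denseRange_lambdaSpace_val.prodMap denseRange_lambdaSpace_val)
    (isPseudocompact_of_compactSpace _) fun f _ => exists_extension_of_lambdaSpace_prod f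

theorem mainTheorem12 :
    T35Space lambdaSpace ∧
    ConnectedSpace lambdaSpace ∧
    ¬ CompactSpace lambdaSpace ∧
    IsPseudocompact lambdaSpace ∧
    IsRRGood lambdaSpace ∧
    IsPseudocompact (lambdaSpace × lambdaSpace) ∧
    ¬ IsRRGood (lambdaSpace × lambdaSpace) ∧
    (∃ e : StoneCech lambdaSpace ≃ₜ StoneCech ℝ,
      ∀ x : lambdaSpace, e (stoneCechUnit x) = (x : StoneCech ℝ)) ∧
    (∃ e : StoneCech (lambdaSpace × lambdaSpace) ≃ₜ StoneCech ℝ × StoneCech ℝ,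
      ∀ p : lambdaSpace × lambdaSpace,
        e (stoneCechUnit p) = ((p.1 : StoneCech ℝ), (p.2 : StoneCech ℝ))) ∧
    ¬ IsRRGood (StoneCech ℝ × StoneCech ℝ) :=
  ⟨inferInstance, connectedSpace_lambdaSpace, not_compactSpace_lambdaSpace,
    isPseudocompact_lambdaSpace, isRRGood_lambdaSpace, isPseudocompact_lambdaSpace_prod,
    not_isRRGood_lambdaSpace_prod, exists_homeomorph_stoneCech_lambdaSpace,
    exists_homeomorph_stoneCech (continuous_subtype_val.prodMap continuous_subtype_val)
      (denseRange_lambdaSpace_val.prodMap denseRange_lambdaSpace_val)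
      fun f _ => exists_extension_of_lambdaSpace_prod f,
    not_isRRGood_stoneCech_real_prod⟩
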